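/- Let $G$ be a finite simple graph on $n$ vertices that is $3K_1$-free, that is, $G$ has no induced subgraph isomorphic to the edgeless graph on three vertices. Let $\chi(G)$ be its chromatic number, and let $\mathcal{C}_k(G)$ denote the $k$-recolouring graph of $G$: its vertices are the proper colourings of $G$ with colours $1,\dots,k$, and two colourings are adjacent when they differ at exactly one vertex of $G$. Then $$\operatorname{diam}\mathcal{C}_{\chi(G)+1}(G)\le\lfloor 7n/2\rfloor,$$ where the diameter is the supremum of the distances between two colourings (infinite if $\mathcal{C}_{\chi(G)+1}(G)$ is disconnected); that is, any two proper $(\chi(G)+1)$-colourings of $G$ can be transformed into each other by recolouring one vertex at a time, always keeping the colouring proper, in at most $\lfloor 7n/2\rfloor$ steps. -/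

import Mathlib

/-- The `k`-recolouring graph of `G`: its vertices are the proper colourings of `G` with colours
`Fin k`, and two of them are adjacent when they differ at exactly one vertex of `G`. -/
def SimpleGraph.recolouringGraph {V : Type*} (G : SimpleGraph V) (k : ℕ) :
    SimpleGraph (G.Coloring (Fin k)) where
  Adj a b := ∃! v : V, a v ≠ b v
  symm := ⟨by
    rintro a b ⟨v, hv, huniq⟩
    exact ⟨v, hv.symm, fun w hw => huniq w (Ne.symm hw)⟩⟩
  loopless := ⟨by
    rintro a ⟨v, hv, -⟩
    exact hv rfl⟩

/-! Fix an optimal colouring γ. Every (χ+1)-colouring reaches, in at most n moves, one with exactly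
the classes of γ. Two such colourings differ by a renaming of colours, which takes at most 3n/2
moves; in total n + 3n/2 + n.

To reach γ's classes: these have at most two vertices, so a count with singletons doubled shows that
a (χ+1)-colouring misses a colour or has a singleton class that is not a class of γ
(`Coloring.not_surjective_of_singletons`). Either way a non-monochromatic class of γ can be made
monochromatic, and this is never undone.

To rename: a cycle of classes is opened by parking a smallest class on a spare colour. A cycle has
at least two classes, so parking costs at most half its size. -/

namespace SimpleGraph

variable {V : Type*} [Fintype V] {G : SimpleGraph V} {k : ℕ}

/-! ### Elementary recolouring moves -/

open Classical in
/-- If no vertex sees a new colour among the old colours of its neighbours, then the vertices can be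
recoloured one by one, in any order. -/
theorem recolouringGraph_edist_le_card_ne (β : G.Coloring (Fin k)) (d : ℕ) :
    ∀ α : G.Coloring (Fin k), (∀ u v, G.Adj u v → α u ≠ β v) →
      (Finset.univ.filter fun v => α v ≠ β v).card = d →
      (G.recolouringGraph k).edist α β ≤ d := by
  induction d with
  | zero =>
    intro α _ hd
    have : α = β := by
      ext1 v
      by_contra hv
      have := Finset.card_eq_zero.1 hd
      have hm : v ∈ Finset.univ.filter fun v => α v ≠ β v := by simpa using hv
      simp [this] at hm
    simp [this]
  | succ d ih =>
    intro α hαβ hd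
    obtain ⟨u, hu⟩ : (Finset.univ.filter fun v => α v ≠ β v).Nonempty := by
      rw [← Finset.card_pos]; omega
    have hu' : α u ≠ β u := by simpa using hu
    let α' : G.Coloring (Fin k) := Coloring.mk (Function.update α u (β u)) (by
      intro x y hxy
      by_cases hx : x = u
      · subst hx
        rw [Function.update_self, Function.update_of_ne hxy.ne']
        exact (hαβ y x hxy.symm).symm
      · rw [Function.update_of_ne hx]
        by_cases hy : y = u
        · subst hy
          rw [Function.update_self]
          exact hαβ x y hxy
        · rw [Function.update_of_ne hy]
          exact α.valid hxy)
    have hval : ∀ x, α' x = Function.update α u (β u) x := fun _ => rfl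
    have hadj : (G.recolouringGraph k).Adj α α' := by
      refine ⟨u, ?_, ?_⟩
      · simpa [hval] using hu'
      · intro w hw
        by_contra hwu
        exact hw (by rw [hval, Function.update_of_ne hwu])
    have h1 : (G.recolouringGraph k).edist α α' ≤ 1 := (edist_eq_one_iff_adj.2 hadj).le
    have h2 : (G.recolouringGraph k).edist α' β ≤ d := by
      apply ih
      · intro x y hxy
        rw [hval]
        by_cases hx : x = u
        · subst hx
          rw [Function.update_self]
          exact β.valid hxy
        · rw [Function.update_of_ne hx]
          exact hαβ x y hxy
      · have : (Finset.univ.filter fun v => α' v ≠ β v)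
            = (Finset.univ.filter fun v => α v ≠ β v).erase u := by
          ext x
          by_cases hx : x = u
          · subst hx; simp [hval]
          · simp [hval, hx]
        rw [this, Finset.card_erase_of_mem hu, hd]; rfl
    calc _ ≤ _ := SimpleGraph.edist_triangle (v := α')
      _ ≤ 1 + d := add_le_add h1 h2
      _ = _ := by push_cast; rw [add_comm]

open Classical in
/-- An independent set can be recoloured with a colour that is not used outside it. -/
theorem exists_coloring_recolour_set (α : G.Coloring (Fin k)) (S : Finset V) (c : Fin k)
    (hS : ∀ u ∈ S, ∀ v ∈ S, ¬ G.Adj u v) (hc : ∀ v, α v = c → v ∈ S) :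
    ∃ α' : G.Coloring (Fin k), (∀ v, α' v = if v ∈ S then c else α v) ∧
      (G.recolouringGraph k).edist α α' ≤ S.card := by
  have key : ∀ x y, G.Adj x y → α x ≠ if y ∈ S then c else α y := by
    intro x y hxy
    split_ifs with hy
    · exact fun h => hS x (hc x h) y hy hxy
    · exact α.valid hxy
  let α' : G.Coloring (Fin k) := Coloring.mk (fun v => if v ∈ S then c else α v) (by
    intro x y hxy
    by_cases hx : x ∈ S
    · by_cases hy : y ∈ S
      · exact absurd hxy (hS x hx y hy)
      · simpa [hx, hy] using (key y x hxy.symm).symm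
    · simpa only [if_neg hx] using key x y hxy)
  refine ⟨α', fun _ => rfl, ?_⟩
  refine (recolouringGraph_edist_le_card_ne α' _ α (fun u v h => key u v h) rfl).trans ?_
  norm_cast
  apply Finset.card_le_card
  intro v hv
  by_contra hvS
  have : α v ≠ if v ∈ S then c else α v := (Finset.mem_filter.1 hv).2
  simp [hvS] at this

/-! ### Renaming the colours of fixed classes -/

open Classical in
/-- Two colourings with the same colour classes use equally many colours, so that if one uses only
colours of the other, then they use the same colours. -/
theorem Coloring.forall_exists_eq_of_same_classes {α β : G.Coloring (Fin k)}
    (h : ∀ u v, α u = α v ↔ β u = β v) (hsub : ∀ v, ∃ w, β w = α v) (v : V) :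
    ∃ w, α w = β v := by
  have hfac : Function.FactorsThrough β α := fun u v huv => (h u v).1 huv
  -- The default `id` is only taken at colours that α does not use.
  have himg : Finset.univ.image β
      = (Finset.univ.image α).image (Function.extend α β id) := by
    rw [Finset.image_image]
    congr 1
    exact (hfac.extend_comp id).symm
  have heq : Finset.univ.image α = Finset.univ.image β := by
    apply Finset.eq_of_subset_of_card_le
    · intro c hc
      obtain ⟨v, -, rfl⟩ := Finset.mem_image.1 hc
      obtain ⟨w, hw⟩ := hsub v
      exact Finset.mem_image.2 ⟨w, Finset.mem_univ _, hw⟩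
    · rw [himg]
      exact Finset.card_image_le
  have : β v ∈ Finset.univ.image α := by rw [heq]; simp
  obtain ⟨w, -, hw⟩ := Finset.mem_image.1 this
  exact ⟨w, hw⟩

open Classical in
/-- A colour class can be moved to an unused colour. -/
theorem exists_coloring_move_class (α : G.Coloring (Fin k)) (v : V) (c : Fin k)
    (hc : ∀ u, α u ≠ c) :
    ∃ α' : G.Coloring (Fin k), (∀ u, α' u = if α u = α v then c else α u) ∧
      (∀ u w, α' u = α' w ↔ α u = α w) ∧
      (G.recolouringGraph k).edist α α' ≤ (Finset.univ.filter fun u => α u = α v).card := by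
  obtain ⟨α', hα', hd⟩ := exists_coloring_recolour_set α
    (Finset.univ.filter fun u => α u = α v) c
    (by
      intro x hx y hy hxy
      simp only [Finset.mem_filter, Finset.mem_univ, true_and] at hx hy
      exact α.valid hxy (hx.trans hy.symm))
    (fun u hu => absurd hu (hc u))
  have hval : ∀ u, α' u = if α u = α v then c else α u := by simpa using hα'
  refine ⟨α', hval, fun u w => ?_, hd⟩
  rw [hval, hval]
  have := hc u
  have := hc w
  split_ifs <;> grind

open Classical in
/-- Moving a misplaced class to its target colour makes its vertices well placed. -/
theorem card_ne_add_card_class {α α' β : G.Coloring (Fin k)} {v : V}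
    (hk : ∀ u w, α u = α w ↔ β u = β w) (hv : α v ≠ β v)
    (hα' : ∀ u, α' u = if α u = α v then β v else α u) :
    (Finset.univ.filter fun u => α' u ≠ β u).card
      + (Finset.univ.filter fun u => α u = α v).card
      = (Finset.univ.filter fun u => α u ≠ β u).card := by
  rw [← Finset.card_union_of_disjoint]
  · congr 1
    ext u
    simp only [Finset.mem_union, Finset.mem_filter, Finset.mem_univ, true_and, hα']
    have := hk u v
    split_ifs <;> grind
  · rw [Finset.disjoint_left]
    intro u
    simp only [Finset.mem_filter, Finset.mem_univ, true_and, hα']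
    have := hk u v
    split_ifs <;> grind

theorem edist_le_nat_add {W : Type*} {R : SimpleGraph W} {a b c : W} {m p : ℕ}
    (h₁ : R.edist a b ≤ m) (h₂ : R.edist b c ≤ p) : R.edist a c ≤ ((m + p : ℕ) : ℕ∞) := by
  push_cast
  exact SimpleGraph.edist_triangle.trans (add_le_add h₁ h₂)

open Classical in
/-- Colourings with the same colour classes, not using some colour, are joined by at most `3 / 2`
moves per misplaced vertex, and fewer if some class of the first has a colour that is not used by
the second. -/
theorem exists_edist_le_of_same_classes (β : G.Coloring (Fin k)) (f : Fin k) (hf : ∀ v, β v ≠ f)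
    (d : ℕ) : ∀ α : G.Coloring (Fin k), (∀ u v, α u = α v ↔ β u = β v) →
      (Finset.univ.filter fun v => α v ≠ β v).card = d →
      (∃ m : ℕ, (G.recolouringGraph k).edist α β ≤ m ∧ 2 * m ≤ 3 * d) ∧
      ∀ v, (∀ w, β w ≠ α v) → ∃ m : ℕ, (G.recolouringGraph k).edist α β ≤ m ∧
        2 * m + (Finset.univ.filter fun u => α u = α v).card ≤ 3 * d := by
  induction d using Nat.strong_induction_on with
  | _ d ih =>
  intro α hk hd
  have hpos : ∀ v, 0 < (Finset.univ.filter fun u => α u = α v).card := fun v =>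
    Finset.card_pos.2 ⟨v, by simp⟩
  have hR : ∀ v, (∀ w, β w ≠ α v) → ∃ m : ℕ, (G.recolouringGraph k).edist α β ≤ m ∧
        2 * m + (Finset.univ.filter fun u => α u = α v).card ≤ 3 * d := by
    intro v hv
    obtain ⟨x, hx⟩ : ∃ x, ∀ w, α w ≠ β x := by
      by_contra! hcon
      obtain ⟨w, hw⟩ := Coloring.forall_exists_eq_of_same_classes
        (fun u v => (hk u v).symm) hcon v
      exact hv w hw
    obtain ⟨α', hval, hker, hdist⟩ := exists_coloring_move_class α x (β x) hx
    have hcard := card_ne_add_card_class hk (hx x) hval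
    have hk' : ∀ u v, α' u = α' v ↔ β u = β v := fun u v => (hker u v).trans (hk u v)
    have hx0 := hpos x
    obtain ⟨ih1, ih2⟩ := ih _ (by omega) α' hk' rfl
    -- A direct move of a class C costs 2|C| of its budget 3|C|. The saving of |C| is kept if C is
    -- the class of v; otherwise the saving comes from induction.
    by_cases hxv : α v = α x
    · obtain ⟨m, hm, hle⟩ := ih1
      refine ⟨_, edist_le_nat_add hdist hm, ?_⟩
      rw [hxv]
      omega
    · have hv' : α' v = α v := by rw [hval, if_neg hxv]
      obtain ⟨m, hm, hle⟩ := ih2 v (by rwa [hv'])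
      refine ⟨_, edist_le_nat_add hdist hm, ?_⟩
      simp only [hker] at hle
      omega
  refine ⟨?_, hR⟩
  by_cases hout : ∃ v, ∀ w, β w ≠ α v
  · obtain ⟨v, hv⟩ := hout
    obtain ⟨m, hm, hle⟩ := hR v hv
    exact ⟨m, hm, by omega⟩
  push Not at hout
  have hout' := Coloring.forall_exists_eq_of_same_classes hk hout
  by_cases hne : (Finset.univ.filter fun v => α v ≠ β v).Nonempty
  swap
  · have : α = β := by
      ext1 v
      by_contra hv
      exact hne ⟨v, by simpa using hv⟩
    exact ⟨0, by simp [this], by omega⟩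
  -- Now α and β use the same colours. The class of v is parked on f and that of x takes the freed
  -- colour. The parked class has a colour outside β, so induction saves its size once; minimality
  -- against the class of x pays for the rest.
  obtain ⟨v, hv, hmin⟩ := Finset.exists_min_image _
    (fun v => (Finset.univ.filter fun u => α u = α v).card) hne
  have hv' : α v ≠ β v := by simpa using hv
  have hfα : ∀ u, α u ≠ f := fun u hu => by
    obtain ⟨w, hw⟩ := hout u
    exact hf w (hw.trans hu)
  obtain ⟨α₁, hval₁, hker₁, hdist₁⟩ := exists_coloring_move_class α v f hfα
  obtain ⟨x, hx⟩ := hout v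
  have hxv : α x ≠ α v := fun h => hv' (by rw [← hx]; exact (hk x v).1 h)
  have hk₁ : ∀ u v, α₁ u = α₁ v ↔ β u = β v := fun u v => (hker₁ u v).trans (hk u v)
  have hfree : ∀ u, α₁ u ≠ β x := fun u => by
    rw [hval₁, hx]
    split_ifs with h
    · exact (hfα v).symm
    · exact h
  obtain ⟨α₂, hval₂, hker₂, hdist₂⟩ := exists_coloring_move_class α₁ x (β x) hfree
  have hk₂ : ∀ u v, α₂ u = α₂ v ↔ β u = β v := fun u v => (hker₂ u v).trans (hk₁ u v)
  have hcard := card_ne_add_card_class hk₁ (hfree x) hval₂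
  have hsame : (Finset.univ.filter fun u => α₁ u ≠ β u)
      = Finset.univ.filter fun u => α u ≠ β u := by
    ext u
    have h1 := hk u v
    have h2 := hf u
    have h3 := hval₁ u
    simp only [Finset.mem_filter, Finset.mem_univ, true_and]
    split_ifs at h3 <;> grind
  have hvx := hmin x (by simpa [hx] using hxv)
  have hx0 := hpos x
  simp only [hker₁] at hcard hdist₂
  rw [hsame] at hcard
  have hα₂v : α₂ v = f := by
    rw [hval₂, if_neg (fun h => hxv ((hker₁ v x).1 h).symm), hval₁, if_pos rfl]
  obtain ⟨m, hm, hle⟩ := (ih _ (by omega) α₂ hk₂ rfl).2 v (by rwa [hα₂v])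
  refine ⟨_, edist_le_nat_add hdist₁ (edist_le_nat_add hdist₂ hm), ?_⟩
  simp only [hker₂, hker₁] at hle
  omega

/-! ### Reaching the classes of an optimal colouring -/

open Classical in
theorem card_fiber_le_two (hG : ¬ (⊥ : SimpleGraph (Fin 3)).IsIndContained G)
    (α : G.Coloring (Fin k)) (c : Fin k) : (Finset.univ.filter fun v => α v = c).card ≤ 2 := by
  by_contra! h
  obtain ⟨x, y, z, hx, hy, hz, hxy, hxz, hyz⟩ := Finset.two_lt_card_iff.1 h
  simp only [Finset.mem_filter, Finset.mem_univ, true_and] at hx hy hz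
  have hmem : ∀ i : Fin 3, α (![x, y, z] i) = c := by
    intro i; fin_cases i <;> simp [hx, hy, hz]
  refine hG ⟨⟨⟨![x, y, z], ?_⟩, ?_⟩⟩
  · intro i j hij
    fin_cases i <;> fin_cases j <;> simp_all
  · intro i j
    simp only [bot_adj, iff_false]
    exact fun hadj => α.valid hadj ((hmem i).trans (hmem j).symm)

open Classical in
/-- Vertices, those in singleton fibres twice, counted fibre by fibre. -/
theorem card_add_card_singleton_fibers (g : V → Fin k) :
    Fintype.card V + (Finset.univ.filter fun v => ∀ w, g w = g v → w = v).card
      = ∑ c, ((Finset.univ.filter fun v => g v = c).card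
        + ((Finset.univ.filter fun v => ∀ w, g w = g v → w = v).filter fun v => g v = c).card) := by
  rw [Finset.sum_add_distrib, ← Finset.card_univ]
  congr 1 <;> exact Finset.card_eq_sum_card_fiberwise fun _ _ => Finset.mem_coe.2 (Finset.mem_univ _)

open Classical in
/-- A colouring with classes of size at most two whose singletons are all singletons of a colouring
with fewer colours misses a colour. -/
theorem Coloring.not_surjective_of_singletons {l : ℕ}
    (hG : ¬ (⊥ : SimpleGraph (Fin 3)).IsIndContained G) (α : G.Coloring (Fin k))
    (γ : G.Coloring (Fin l)) (hlk : l < k)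
    (h : ∀ v, (∀ w, α w = α v → w = v) → ∀ w, γ w = γ v → w = v) :
    ¬ Function.Surjective α := by
  intro hsurj
  have hα := card_add_card_singleton_fibers α
  have hγ := card_add_card_singleton_fibers γ
  have hle := Finset.card_le_card (Finset.monotone_filter_right Finset.univ
    (p := fun v => ∀ w, α w = α v → w = v) (q := fun v => ∀ w, γ w = γ v → w = v)
    fun v _ => h v)
  -- A singleton counts 1 + 1, a pair 2 + 0, an empty class 0.
  have h1 : ∑ c, ((Finset.univ.filter fun v => γ v = c).card
        + ((Finset.univ.filter fun v => ∀ w, γ w = γ v → w = v).filter fun v => γ v = c).card)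
      ≤ ∑ _c : Fin l, 2 := by
    refine Finset.sum_le_sum fun c _ => ?_
    by_cases hc : ∃ v, γ v = c ∧ ∀ w, γ w = γ v → w = v
    · obtain ⟨v, rfl, hv⟩ := hc
      have hsub : (Finset.univ.filter fun u => γ u = γ v) ⊆ {v} := by
        intro u hu
        simpa using hv u (by simpa using hu)
      have h1 := Finset.card_le_card hsub
      have h2 := Finset.card_le_card ((Finset.filter_subset_filter _
        (Finset.subset_univ (Finset.univ.filter fun v => ∀ w, γ w = γ v → w = v))).trans hsub)
      simp only [Finset.card_singleton] at h1 h2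
      omega
    · have : ((Finset.univ.filter fun v => ∀ w, γ w = γ v → w = v).filter
          fun v => γ v = c) = ∅ := by
        apply Finset.filter_eq_empty_iff.2
        intro v hv hvc
        exact hc ⟨v, hvc, by simpa using hv⟩
      rw [this, Finset.card_empty]
      exact card_fiber_le_two hG γ c
  have h2 : ∑ _c : Fin k, 2 ≤ ∑ c, ((Finset.univ.filter fun v => α v = c).card
        + ((Finset.univ.filter fun v => ∀ w, α w = α v → w = v).filter
          fun v => α v = c).card) := by
    refine Finset.sum_le_sum fun c _ => ?_
    obtain ⟨v, rfl⟩ := hsurj c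
    by_cases hv : ∀ w, α w = α v → w = v
    · have h1 : 0 < (Finset.univ.filter fun u => α u = α v).card :=
        Finset.card_pos.2 ⟨v, by simp⟩
      have h2 : 0 < ((Finset.univ.filter fun v => ∀ w, α w = α v → w = v).filter
          fun u => α u = α v).card := Finset.card_pos.2 ⟨v, by simpa using hv⟩
      omega
    · push Not at hv
      obtain ⟨w, hw, hwv⟩ := hv
      have : 1 < (Finset.univ.filter fun u => α u = α v).card :=
        Finset.one_lt_card.2 ⟨w, by simpa using hw, v, by simp, hwv⟩
      omega
  simp only [Finset.sum_const, Finset.card_univ, Fintype.card_fin, smul_eq_mul] at h1 h2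
  omega

open Classical in
/-- Any colouring can be recoloured, with at most one move per vertex of the classes of `γ` that are
not monochromatic, so that all classes of `γ` become monochromatic. -/
theorem exists_edist_le_classes_monochromatic {l : ℕ}
    (hG : ¬ (⊥ : SimpleGraph (Fin 3)).IsIndContained G) (γ : G.Coloring (Fin l)) (hlk : l < k)
    (d : ℕ) : ∀ α : G.Coloring (Fin k),
      (Finset.univ.filter fun v => ∃ w, γ w = γ v ∧ α w ≠ α v).card = d →
      ∃ α' : G.Coloring (Fin k), (∀ v w, γ w = γ v → α' w = α' v) ∧
        (G.recolouringGraph k).edist α α' ≤ d := by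
  induction d using Nat.strong_induction_on with
  | _ d ih =>
  intro α hd
  by_cases hbad : ∃ v w, γ w = γ v ∧ α w ≠ α v
  swap
  · push Not at hbad
    exact ⟨α, hbad, by simp⟩
  -- Here c is either unused by α or the colour of a singleton of α inside a larger class of γ.
  obtain ⟨v, c, hv, hc⟩ : ∃ v c, (∃ w, γ w = γ v ∧ α w ≠ α v) ∧
      ∀ x, α x = c → γ x = γ v := by
    by_contra! hcon
    obtain ⟨v, hv⟩ := hbad
    refine Coloring.not_surjective_of_singletons hG α γ hlk (fun u hu w hw => ?_) (fun c => ?_)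
    · by_contra hwu
      obtain ⟨x, hx, hxu⟩ := hcon u (α u) ⟨w, hw, fun h => hwu (hu w h)⟩
      exact hxu (by rw [hu x hx])
    · obtain ⟨x, hx, -⟩ := hcon v c hv
      exact ⟨x, hx⟩
  obtain ⟨α₁, hval, hdist⟩ := exists_coloring_recolour_set α
    (Finset.univ.filter fun u => γ u = γ v) c
    (by
      intro x hx y hy hxy
      simp only [Finset.mem_filter, Finset.mem_univ, true_and] at hx hy
      exact γ.valid hxy (hx.trans hy.symm))
    (fun u hu => by simpa using hc u hu)
  simp only [Finset.mem_filter, Finset.mem_univ, true_and] at hval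
  have hcard : (Finset.univ.filter fun u => ∃ w, γ w = γ u ∧ α₁ w ≠ α₁ u).card
      + (Finset.univ.filter fun u => γ u = γ v).card ≤ d := by
    rw [← hd, ← Finset.card_union_of_disjoint]
    · apply Finset.card_le_card
      intro u
      simp only [Finset.mem_union, Finset.mem_filter, Finset.mem_univ, true_and]
      by_cases hu : γ u = γ v
      · intro _
        obtain ⟨w, hw, hwv⟩ := hv
        by_cases h : α v = α u
        · exact ⟨w, hw.trans hu.symm, by rwa [← h]⟩
        · exact ⟨v, hu.symm, h⟩
      · rintro (⟨w, hw, hwu⟩ | h)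
        · rw [hval, hval, if_neg hu, if_neg (hw ▸ hu)] at hwu
          exact ⟨w, hw, hwu⟩
        · exact absurd h hu
    · rw [Finset.disjoint_left]
      simp only [Finset.mem_filter, Finset.mem_univ, true_and]
      rintro u ⟨w, hw, hwu⟩ hu
      rw [hval, hval, if_pos hu, if_pos (hw.trans hu)] at hwu
      exact hwu rfl
  have hpos : 0 < (Finset.univ.filter fun u => γ u = γ v).card :=
    Finset.card_pos.2 ⟨v, by simp⟩
  obtain ⟨α', hα', hd'⟩ := ih _ (by omega) α₁ rfl
  refine ⟨α', hα', (edist_le_nat_add hdist hd').trans (Nat.cast_le.2 ?_)⟩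
  rwa [add_comm]

omit [Fintype V] in
open Classical in
/-- If all classes of a colouring with the fewest colours are monochromatic for `α`, then they are
the classes of `α`. -/
theorem Coloring.eq_of_classes_monochromatic {χ : ℕ} (hχ : G.chromaticNumber = (χ : ℕ∞))
    (γ : G.Coloring (Fin χ)) {α : G.Coloring (Fin k)} (h : ∀ v w, γ w = γ v → α w = α v)
    {v w : V} (hvw : α v = α w) : γ v = γ w := by
  by_contra hne
  -- The γ-classes of v and w share one α-colour, so their union is independent and merging them
  -- saves a colour.
  let δ : G.Coloring {c : Fin χ // c ≠ γ w} :=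
    Coloring.mk (fun u => if hu : γ u = γ w then ⟨γ v, hne⟩ else ⟨γ u, hu⟩) (by
      intro x y hxy
      have h0 := γ.valid hxy
      have h1 := α.valid hxy
      have h2 := h w x
      have h3 := h w y
      have h4 := h v x
      have h5 := h v y
      split_ifs <;> simp only [ne_eq, Subtype.mk.injEq] <;> grind)
  have hcol := δ.colorable
  rw [Fintype.card_subtype_compl, Fintype.card_fin, Fintype.card_unique] at hcol
  have := hcol.chromaticNumber_le
  rw [hχ, Nat.cast_le] at this
  have := (γ w).pos
  omega

end SimpleGraph

theorem mainTheorem7 {V : Type*} [Fintype V] (G : SimpleGraph V)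
    (hG : ¬ (⊥ : SimpleGraph (Fin 3)).IsIndContained G)
    (χ : ℕ) (hχ : G.chromaticNumber = (χ : ℕ∞)) :
    (G.recolouringGraph (χ + 1)).ediam ≤ ((7 * Fintype.card V / 2 : ℕ) : ℕ∞) := by
  classical
  obtain ⟨γ⟩ : G.Colorable χ := SimpleGraph.chromaticNumber_le_iff_colorable.1 hχ.le
  have reach : ∀ α : G.Coloring (Fin (χ + 1)), ∃ α' : G.Coloring (Fin (χ + 1)),
      (∀ v w, α' v = α' w ↔ γ v = γ w) ∧
        (G.recolouringGraph (χ + 1)).edist α α' ≤ Fintype.card V := by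
    intro α
    obtain ⟨α', hα', hd⟩ :=
      SimpleGraph.exists_edist_le_classes_monochromatic hG γ χ.lt_succ_self _ α rfl
    refine ⟨α', fun v w => ⟨fun h => SimpleGraph.Coloring.eq_of_classes_monochromatic hχ γ hα' h,
      hα' w v⟩, hd.trans ?_⟩
    exact_mod_cast Finset.card_le_univ _
  refine iSup₂_le fun α β => ?_
  obtain ⟨α', hα', hα⟩ := reach α
  obtain ⟨β', hβ', hβ⟩ := reach β
  -- β' has the classes of γ, so at most χ of the χ + 1 colours occur.
  obtain ⟨f, hf⟩ : ∃ f, ∀ v, β' v ≠ f := by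
    by_contra! hcon
    choose g hg using hcon
    have hinj : Function.Injective (fun c => γ (g c)) := fun a b hab => by
      rw [← hg a, ← hg b]
      exact (hβ' _ _).2 hab
    simpa using Fintype.card_le_of_injective _ hinj
  obtain ⟨m, hm, hle⟩ := (SimpleGraph.exists_edist_le_of_same_classes β' f hf _ α'
    (fun u v => (hα' u v).trans (hβ' u v).symm) rfl).1
  rw [SimpleGraph.edist_comm] at hβ
  refine (SimpleGraph.edist_le_nat_add hα (SimpleGraph.edist_le_nat_add hm hβ)).trans ?_
  have := Finset.card_le_univ (Finset.univ.filter fun v => α' v ≠ β' v)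
  norm_cast
  omega
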